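/- Let $n\ge 1$. A \emph{strongly pseudoconvex real analytic real hypersurface} in $\mathbb{C}^{n+1}$ is a set $M\subset\mathbb{C}^{n+1}$ such that every $z\in M$ has an open neighborhood $V$ carrying a real analytic function $\rho:V\to\mathbb{R}$ with $d\rho\neq 0$ on $V$, $M\cap V=\{\rho=0\}$, and $$\sum_{j,k}\frac{\partial^2\rho}{\partial z_j\,\partial\overline{z}_k}(z)\,v_j\overline{v}_k>0\quad\text{for all } v\in\mathbb{C}^{n+1}\setminus\{0\}\text{ with }\sum_j\frac{\partial\rho}{\partial z_j}(z)\,v_j=0 .$$ Let $M,M'$ be strongly pseudoconvex real analytic real hypersurfaces in $\mathbb{C}^{n+1}$, let $U$ be an open neighborhood of a point $p\in M$, and let $\phi:U\to\mathbb{C}^{n+1}$ be a holomorphic mapping such that $$\phi(U\cap M)\subset M'.$$ Then, after shrinking $U$ if necessary, $\phi$ is either constant or biholomorphic on $U$; that is, there is an open neighborhood $V\subset U$ of $p$ such that either $\phi$ is constant on $V$, or $\phi$ maps $V$ biholomorphically onto an open subset of $\mathbb{C}^{n+1}$. -/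

import Mathlib

/-- The complex Euclidean space of `m` complex dimensions. -/
abbrev ComplexSpace (m : ℕ) : Type := EuclideanSpace ℂ (Fin m)

/-- `ρ` is a real analytic local defining function on the open set `V` for the set `M`:
it is real analytic on `V`, its real differential vanishes nowhere on `V`, and inside `V` the
set `M` is exactly the zero set of `ρ`. -/
structure IsAnalyticDefiningFunction {m : ℕ} (M V : Set (ComplexSpace m))
    (ρ : ComplexSpace m → ℝ) : Prop where
  isOpen : IsOpen V
  analytic : AnalyticOnNhd ℝ ρ V
  fderiv_ne_zero : ∀ z ∈ V, fderiv ℝ ρ z ≠ 0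
  inter_eq : M ∩ V = {z ∈ V | ρ z = 0}

/-- The complex tangent space at `z` of the level set of `ρ` through `z`: the vectors `v` with
`∑ j, (∂ρ/∂z_j)(z) v_j = 0`, that is, those `v` for which both `v` and `i v` are annihilated by the
real differential of `ρ` at `z`. -/
def complexTangentSpace {m : ℕ} (ρ : ComplexSpace m → ℝ) (z : ComplexSpace m) :
    Set (ComplexSpace m) :=
  {v | fderiv ℝ ρ z v = 0 ∧ fderiv ℝ ρ z (Complex.I • v) = 0}

/-- The Levi form of `ρ` at `z` in the direction `v`,
`∑ j k, (∂²ρ/∂z_j ∂z̄_k)(z) v_j v̄_k = (D²ρ(z)(v, v) + D²ρ(z)(i v, i v)) / 4`,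
where `D²ρ(z)` is the second real derivative of `ρ` at `z`. -/
noncomputable def leviForm {m : ℕ} (ρ : ComplexSpace m → ℝ) (z v : ComplexSpace m) : ℝ :=
  (fderiv ℝ (fderiv ℝ ρ) z v v
    + fderiv ℝ (fderiv ℝ ρ) z (Complex.I • v) (Complex.I • v)) / 4

/-- `M` is a strongly pseudoconvex real analytic (embedded, not necessarily closed) real
hypersurface: near each of its points `z` it has a real analytic local defining function whose
Levi form at `z` is positive definite on the complex tangent space at `z`. Since `ρ` may be
replaced by `-ρ`, no side of `M` is singled out beforehand. -/
def IsStronglyPseudoconvexAnalyticHypersurface {m : ℕ} (M : Set (ComplexSpace m)) : Prop :=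
  ∀ z ∈ M, ∃ (V : Set (ComplexSpace m)) (ρ : ComplexSpace m → ℝ),
    z ∈ V ∧ IsAnalyticDefiningFunction M V ρ ∧
      ∀ v ∈ complexTangentSpace ρ z, v ≠ 0 → 0 < leviForm ρ z v

/-- `φ` is a biholomorphic mapping of the open set `V` onto its image: the image is open, `φ` is
holomorphic and injective on `V`, and the inverse mapping is holomorphic on the image. -/
structure IsBiholomorphicOn {m : ℕ} (φ : ComplexSpace m → ComplexSpace m)
    (V : Set (ComplexSpace m)) : Prop where
  isOpen : IsOpen V
  isOpen_image : IsOpen (φ '' V)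
  holomorphic : AnalyticOnNhd ℂ φ V
  injOn : Set.InjOn φ V
  exists_inverse : ∃ ψ : ComplexSpace m → ComplexSpace m,
    AnalyticOnNhd ℂ ψ (φ '' V) ∧ ∀ z ∈ V, ψ (φ z) = z

/-!
Add to a defining function of `M'` a large multiple of its square to make it a strictly
plurisubharmonic function `σ` near `φ p`. Then `u = σ ∘ φ` is plurisubharmonic near `p` and
vanishes on `M = {ρ = 0}`. There is a small analytic disc through `p` on which `ρ > 0` away from
`p`; the part of each of its small translates on the side `{ρ ≤ 0}` is bounded by points of `M`,
so the maximum principle gives `u ≤ 0` on that side. By the strong maximum principle and the Hopf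
lemma, either `u = 0` near `p` or `du ≠ 0` at `p`. In the first case, the Levi form of `u`, which
is the pullback by `dφ` of that of `σ`, is zero, so `dφ = 0` and `φ` is constant. In the second
case, `u` and `ρ` have the same differential at `p` and the same second-order jet along `M` up to
a nonzero factor `c`. Hence a vector `v` killed by `dφ` at `p` is complex tangent to `M`, and the
Levi form of `ρ` at `v` is `c⁻¹` times that of `σ` at `dφ v = 0`, so that `v = 0`.
-/

open Filter Topology Metric Set
open scoped ContDiff

section SecondDerivatives

variable {E F : Type*} [NormedAddCommGroup E] [NormedSpace ℝ E]
  [NormedAddCommGroup F] [NormedSpace ℝ F] {f : E → ℝ} {x : E}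

theorem hasFDerivAt_fderiv_of_contDiffAt_two {g : E → F} (hg : ContDiffAt ℝ 2 g x) :
    HasFDerivAt (fderiv ℝ g) (fderiv ℝ (fderiv ℝ g) x) x :=
  ((hg.fderiv_right (m := 1) (by norm_num)).differentiableAt one_ne_zero).hasFDerivAt

theorem continuousAt_fderiv_fderiv {g : E → F} (hg : ContDiffAt ℝ 2 g x) :
    ContinuousAt (fderiv ℝ (fderiv ℝ g)) x :=
  ((hg.fderiv_right (m := 1) (by norm_num)).fderiv_right (m := 0) (by norm_num)).continuousAt

theorem continuousAt_fderiv_fderiv_apply (hf : ContDiffAt ℝ 2 f x) (v : E) :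
    ContinuousAt (fun a : E × E => fderiv ℝ (fderiv ℝ f) a.1 a.2 a.2) (x, v) := by
  have hD : ContinuousAt (fun a : E × E => fderiv ℝ (fderiv ℝ f) a.1) (x, v) :=
    ContinuousAt.comp (f := Prod.fst) (continuousAt_fderiv_fderiv hf) continuousAt_fst
  exact (hD.clm_apply continuousAt_snd).clm_apply continuousAt_snd

theorem eventually_contDiffAt_two {g : E → F} (hg : ContDiffAt ℝ 2 g x) :
    ∀ᶠ y in 𝓝 x, ContDiffAt ℝ 2 g y :=
  hg.eventually (by norm_num)

theorem fderiv_fderiv_comp {G : Type*} [NormedAddCommGroup G] [NormedSpace ℝ G] {g : F → G}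
    {h : E → F} (hg : ContDiffAt ℝ 2 g (h x)) (hh : ContDiffAt ℝ 2 h x) (v w : E) :
    fderiv ℝ (fderiv ℝ (fun y => g (h y))) x v w =
      fderiv ℝ (fderiv ℝ g) (h x) (fderiv ℝ h x v) (fderiv ℝ h x w) +
        fderiv ℝ g (h x) (fderiv ℝ (fderiv ℝ h) x v w) := by
  have hfderiv : fderiv ℝ (fun y => g (h y)) =ᶠ[𝓝 x]
      fun y => (fderiv ℝ g (h y)).comp (fderiv ℝ h y) := by
    filter_upwards [hh.continuousAt.eventually (eventually_contDiffAt_two hg),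
      eventually_contDiffAt_two hh] with y hgy hhy
    exact fderiv_comp y (hgy.differentiableAt two_ne_zero) (hhy.differentiableAt two_ne_zero)
  have hderiv : HasFDerivAt h (fderiv ℝ h x) x := (hh.differentiableAt two_ne_zero).hasFDerivAt
  have hcomp := ((hasFDerivAt_fderiv_of_contDiffAt_two hg).comp x hderiv).clm_comp
    (hasFDerivAt_fderiv_of_contDiffAt_two hh)
  rw [(hcomp.congr_of_eventuallyEq hfderiv).fderiv]
  simp [add_comm]

theorem hasDerivAt_comp_line {g : E → F} {v : E} {s : ℝ}
    (hg : DifferentiableAt ℝ g (x + s • v)) :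
    HasDerivAt (fun t : ℝ => g (x + t • v)) (fderiv ℝ g (x + s • v) v) s := by
  have hline : HasDerivAt (fun t : ℝ => x + t • v) v s := by
    simpa using ((hasDerivAt_id s).smul_const v).const_add x
  exact hg.hasFDerivAt.comp_hasDerivAt s hline

theorem hasDerivAt_fderiv_comp_line {v : E} {s : ℝ} (hf : ContDiffAt ℝ 2 f (x + s • v)) :
    HasDerivAt (fun t : ℝ => fderiv ℝ f (x + t • v) v)
      (fderiv ℝ (fderiv ℝ f) (x + s • v) v v) s := by
  simpa using (hasDerivAt_comp_line
    (hasFDerivAt_fderiv_of_contDiffAt_two hf).differentiableAt).clm_apply (hasDerivAt_const s v)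

theorem eventually_lt_of_fderiv_pos {v : E} (hf : DifferentiableAt ℝ f x)
    (hv : 0 < fderiv ℝ f x v) : ∀ᶠ s in 𝓝[>] (0 : ℝ), f x < f (x + s • v) := by
  have hderiv : HasDerivAt (fun s : ℝ => f (x + s • v) - f x) (fderiv ℝ f x v) 0 := by
    simpa using (hasDerivAt_comp_line (s := 0) (v := v) (by simpa using hf)).sub_const (f x)
  have hsign := eventually_nhdsWithin_sign_eq_of_deriv_pos (hderiv.deriv.symm ▸ hv) (by simp)
  filter_upwards [hsign.filter_mono nhdsWithin_le_nhds, self_mem_nhdsWithin] with s hs hpos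
  rwa [sub_zero, sign_pos (mem_Ioi.mp hpos : 0 < s), sign_eq_one_iff, sub_pos] at hs

theorem fderiv_fderiv_apply_nonpos_of_isLocalMax (hf : ContDiffAt ℝ 2 f x)
    (hmax : IsLocalMax f x) (v : E) : fderiv ℝ (fderiv ℝ f) x v v ≤ 0 := by
  by_contra! hpos
  set line : ℝ → E := fun s => x + s • v
  have hline : Tendsto line (𝓝 0) (𝓝 x) := by
    have : Continuous line := by fun_prop
    simpa [line] using this.tendsto 0
  have hline_zero : line 0 = x := by simp [line]
  have hderiv : deriv (fun s => f (line s)) =ᶠ[𝓝 0] fun s => fderiv ℝ f (line s) v := by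
    filter_upwards [hline.eventually (eventually_contDiffAt_two hf)] with s hs
    exact (hasDerivAt_comp_line (hs.differentiableAt two_ne_zero)).deriv
  have hderiv_deriv : deriv (deriv fun s => f (line s)) 0 = fderiv ℝ (fderiv ℝ f) x v v := by
    rw [hderiv.deriv_eq]
    simpa [line] using (hasDerivAt_fderiv_comp_line (s := 0) (v := v) (by simpa using hf)).deriv
  have hmax_line : IsLocalMax (fun s => f (line s)) 0 := by
    filter_upwards [hline.eventually hmax] with s hs
    simpa only [hline_zero] using hs
  have hmin_line : IsLocalMin (fun s => f (line s)) 0 :=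
    isLocalMin_of_deriv_deriv_pos (hderiv_deriv ▸ hpos) hmax_line.deriv_eq_zero
      (ContinuousAt.comp (hline_zero.symm ▸ hf.continuousAt) (by fun_prop))
  have hconst : (fun s => f (line s)) =ᶠ[𝓝 0] fun _ => f x := by
    filter_upwards [hmax_line, hmin_line] with s hle hge
    simpa only [hline_zero] using le_antisymm hle hge
  have hzero : deriv (deriv fun s => f (line s)) 0 = 0 := by
    rw [hconst.deriv.deriv_eq]
    simp
  exact hpos.ne' (hderiv_deriv ▸ hzero)

theorem eventually_fderiv_fderiv_apply_pos_of_coercive {c : ℝ} (hf : ContDiffAt ℝ 2 f x)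
    (hc : 0 < c) (hcoer : ∀ v, c * ‖v‖ ^ 2 ≤ fderiv ℝ (fderiv ℝ f) x v v) :
    ∀ᶠ y in 𝓝 x, ∀ v ≠ 0, 0 < fderiv ℝ (fderiv ℝ f) y v v := by
  have hnear : ∀ᶠ y in 𝓝 x, ‖fderiv ℝ (fderiv ℝ f) y - fderiv ℝ (fderiv ℝ f) x‖ < c :=
    (continuousAt_fderiv_fderiv hf).eventually
      (eventually_norm_sub_lt (E := E →L[ℝ] E →L[ℝ] ℝ) _ hc)
  filter_upwards [hnear] with y hy v hv
  have hdiff : |fderiv ℝ (fderiv ℝ f) y v v - fderiv ℝ (fderiv ℝ f) x v v| < c * ‖v‖ ^ 2 :=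
    calc |fderiv ℝ (fderiv ℝ f) y v v - fderiv ℝ (fderiv ℝ f) x v v|
      _ ≤ ‖fderiv ℝ (fderiv ℝ f) y - fderiv ℝ (fderiv ℝ f) x‖ * ‖v‖ * ‖v‖ :=
        (fderiv ℝ (fderiv ℝ f) y - fderiv ℝ (fderiv ℝ f) x).le_opNorm₂ v v
      _ < c * ‖v‖ ^ 2 := by
        rw [mul_assoc, ← sq]
        gcongr
  linarith [hcoer v, (abs_lt.mp hdiff).1]

theorem eventually_lt_of_fderiv_fderiv_coercive {c : ℝ} (hf : ContDiffAt ℝ 2 f x)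
    (hcrit : fderiv ℝ f x = 0) (hc : 0 < c)
    (hcoer : ∀ v, c * ‖v‖ ^ 2 ≤ fderiv ℝ (fderiv ℝ f) x v v) :
    ∀ᶠ y in 𝓝[≠] x, f x < f y := by
  obtain ⟨r, hr, hball⟩ := Metric.eventually_nhds_iff_ball.mp
    ((eventually_contDiffAt_two hf).and
      (eventually_fderiv_fderiv_apply_pos_of_coercive hf hc hcoer))
  filter_upwards [nhdsWithin_le_nhds (ball_mem_nhds x hr), self_mem_nhdsWithin] with y hy hne
  set v := y - x
  have hv : v ≠ 0 := sub_ne_zero.mpr hne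
  have hline : ∀ s ∈ Icc (0 : ℝ) 1, x + s • v ∈ ball x r := fun s hs =>
    (convex_ball x r).add_smul_sub_mem (mem_ball_self hr) hy hs
  have hderiv : ∀ s ∈ Icc (0 : ℝ) 1,
      HasDerivAt (fun t : ℝ => f (x + t • v)) (fderiv ℝ f (x + s • v) v) s := fun s hs =>
    hasDerivAt_comp_line ((hball _ (hline s hs)).1.differentiableAt two_ne_zero)
  have hderiv_mono : StrictMonoOn (fun s : ℝ => fderiv ℝ f (x + s • v) v) (Icc 0 1) := by
    have hderiv_deriv := fun s hs => hasDerivAt_fderiv_comp_line (hball _ (hline s hs)).1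
    refine strictMonoOn_of_deriv_pos (convex_Icc 0 1)
      (fun s hs => (hderiv_deriv s hs).continuousAt.continuousWithinAt) fun s hs => ?_
    have hs' := interior_subset hs
    rw [(hderiv_deriv s hs').deriv]
    exact (hball _ (hline s hs')).2 v hv
  have hmono : StrictMonoOn (fun s : ℝ => f (x + s • v)) (Icc 0 1) := by
    refine strictMonoOn_of_deriv_pos (convex_Icc 0 1)
      (fun s hs => (hderiv s hs).continuousAt.continuousWithinAt) fun s hs => ?_
    rw [(hderiv s (interior_subset hs)).deriv]
    rw [interior_Icc] at hs
    simpa [hcrit] using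
      hderiv_mono (left_mem_Icc.mpr zero_le_one) (Ioo_subset_Icc_self hs) hs.1
  simpa [v] using hmono (left_mem_Icc.mpr zero_le_one) (right_mem_Icc.mpr zero_le_one) one_pos

theorem exists_curve_of_fderiv_apply_eq_zero {ρ : E → ℝ} {n : ℕ∞ω} (hρ : ContDiffAt ℝ n ρ x)
    (hn : n ≠ 0) (hdρ : fderiv ℝ ρ x ≠ 0) {v : E} (hv : fderiv ℝ ρ x v = 0) :
    ∃ γ : ℝ → E, ContDiffAt ℝ n γ 0 ∧ γ 0 = x ∧ fderiv ℝ γ 0 1 = v ∧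
      ∀ᶠ s in 𝓝 0, ρ (γ s) = ρ x := by
  obtain ⟨ν, hν⟩ : ∃ ν, fderiv ℝ ρ x ν ≠ 0 := by
    contrapose! hdρ
    exact ContinuousLinearMap.ext hdρ
  obtain ⟨Λ, hΛ⟩ : ∃ Λ : ℝ × ℝ →L[ℝ] E, ∀ s t, Λ (s, t) = s • v + t • ν :=
    ⟨(ContinuousLinearMap.toSpanSingleton ℝ v).coprod
      (ContinuousLinearMap.toSpanSingleton ℝ ν), by simp⟩
  have hρΛ : ContDiffAt ℝ n (fun a => ρ (x + Λ a)) 0 :=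
    ContDiffAt.comp 0 (by simpa using hρ) (by fun_prop)
  have hρΛ_deriv : fderiv ℝ (fun a => ρ (x + Λ a)) 0 = (fderiv ℝ ρ x).comp Λ := by
    have hρ_deriv : HasFDerivAt ρ (fderiv ℝ ρ x) (x + Λ 0) := by
      simpa using (hρ.differentiableAt hn).hasFDerivAt
    exact (hρ_deriv.comp 0 (Λ.hasFDerivAt.const_add x)).fderiv
  have hinv : (fderiv ℝ (fun a => ρ (x + Λ a)) 0 ∘L .inr ℝ ℝ ℝ).IsInvertible := by
    refine ⟨ContinuousLinearEquiv.unitsEquivAut ℝ (Units.mk0 _ hν), ?_⟩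
    rw [hρΛ_deriv]
    ext
    simp [hΛ]
  set τ : ℝ → ℝ := hρΛ.implicitFunction hn hinv
  have hτ : ContDiffAt ℝ n τ 0 := hρΛ.contDiffAt_implicitFunction hn hinv
  have hτ_zero : τ 0 = 0 := hρΛ.implicitFunction_apply_self hn hinv
  set γ : ℝ → E := fun s => x + Λ (s, τ s)
  have hγ : ContDiffAt ℝ n γ 0 := by fun_prop
  have hγ_zero : γ 0 = x := by simp [γ, hΛ, hτ_zero]
  have hlevel : ∀ᶠ s in 𝓝 0, ρ (γ s) = ρ x := by
    simpa using hρΛ.eventually_apply_implicitFunction hn hinv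
  have hγ_deriv : HasDerivAt γ (v + deriv τ 0 • ν) 0 := by
    have hpair : HasDerivAt (fun s => (s, τ s)) (1, deriv τ 0) 0 :=
      (hasDerivAt_id 0).prodMk (hτ.differentiableAt hn).hasDerivAt
    simpa [γ, hΛ] using (Λ.hasFDerivAt.comp_hasDerivAt 0 hpair).const_add x
  have hτ_deriv : deriv τ 0 = 0 := by
    have hρ_deriv : HasFDerivAt ρ (fderiv ℝ ρ x) (γ 0) :=
      hγ_zero ▸ (hρ.differentiableAt hn).hasFDerivAt
    have hzero : fderiv ℝ ρ x (v + deriv τ 0 • ν) = 0 :=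
      (hρ_deriv.comp_hasDerivAt 0 hγ_deriv).unique
        ((hasDerivAt_const 0 (ρ x)).congr_of_eventuallyEq hlevel)
    simpa [hv, hν] using hzero
  refine ⟨γ, hγ, hγ_zero, ?_, hlevel⟩
  simpa [hτ_deriv] using hγ_deriv.deriv

theorem fderiv_apply_eq_zero_of_comp_eventuallyEq_zero {g : F → ℝ} {h : E → F}
    (hg : ContDiffAt ℝ 2 g (h x)) (hh : ContDiffAt ℝ 2 h x)
    (hzero : (fun y => g (h y)) =ᶠ[𝓝 x] fun _ => 0) (v : E) :
    fderiv ℝ g (h x) (fderiv ℝ h x v) = 0 ∧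
      fderiv ℝ (fderiv ℝ g) (h x) (fderiv ℝ h x v) (fderiv ℝ h x v) +
        fderiv ℝ g (h x) (fderiv ℝ (fderiv ℝ h) x v v) = 0 := by
  rw [← fderiv_fderiv_comp hg hh, ← ContinuousLinearMap.comp_apply,
    ← fderiv_fun_comp x (hg.differentiableAt two_ne_zero) (hh.differentiableAt two_ne_zero),
    hzero.fderiv_eq, hzero.fderiv.fderiv_eq]
  simp

theorem exists_fderiv_eq_smul_of_eventually_eq_zero {ρ u : E → ℝ} (hρ : ContDiffAt ℝ 2 ρ x)
    (hu : ContDiffAt ℝ 2 u x) (hdρ : fderiv ℝ ρ x ≠ 0) (hρx : ρ x = 0)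
    (hzero : ∀ᶠ y in 𝓝 x, ρ y = 0 → u y = 0) :
    ∃ c : ℝ, fderiv ℝ u x = c • fderiv ℝ ρ x ∧ ∀ v, fderiv ℝ ρ x v = 0 →
      fderiv ℝ (fderiv ℝ u) x v v = c * fderiv ℝ (fderiv ℝ ρ) x v v := by
  have hjet : ∀ v, fderiv ℝ ρ x v = 0 → fderiv ℝ u x v = 0 ∧
      ∃ k, fderiv ℝ (fderiv ℝ ρ) x v v + fderiv ℝ ρ x k = 0 ∧
        fderiv ℝ (fderiv ℝ u) x v v + fderiv ℝ u x k = 0 := by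
    intro v hv
    obtain ⟨γ, hγ, rfl, rfl, hlevel⟩ :=
      exists_curve_of_fderiv_apply_eq_zero hρ two_ne_zero hdρ hv
    rw [hρx] at hlevel
    have huγ := hγ.continuousAt.eventually hzero
    have hu_jet := fderiv_apply_eq_zero_of_comp_eventuallyEq_zero hu hγ (hlevel.mp huγ) 1
    exact ⟨hu_jet.1, _, (fderiv_apply_eq_zero_of_comp_eventuallyEq_zero hρ hγ hlevel 1).2,
      hu_jet.2⟩
  obtain ⟨ν, hν⟩ : ∃ ν, fderiv ℝ ρ x ν ≠ 0 := by
    contrapose! hdρ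
    exact ContinuousLinearMap.ext hdρ
  have hdu : fderiv ℝ u x = (fderiv ℝ u x ν / fderiv ℝ ρ x ν) • fderiv ℝ ρ x := by
    ext v
    have hker : fderiv ℝ u x (v - (fderiv ℝ ρ x v / fderiv ℝ ρ x ν) • ν) = 0 :=
      (hjet _ (by simp [hν])).1
    simp only [map_sub, map_smul, smul_eq_mul, sub_eq_zero] at hker
    simp only [hker, smul_apply, smul_eq_mul]
    ring
  refine ⟨_, hdu, fun v hv => ?_⟩
  obtain ⟨k, hρk, huk⟩ := (hjet v hv).2
  rw [hdu, smul_apply, smul_eq_mul] at huk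
  linear_combination huk - (fderiv ℝ u x ν / fderiv ℝ ρ x ν) * hρk

end SecondDerivatives

theorem exists_pos_forall_add_mul_pos {X : Type*} [TopologicalSpace X] [T2Space X] {K : Set X}
    (hK : IsCompact K) {f g : X → ℝ} (hf : ContinuousOn f K) (hg : ContinuousOn g K)
    (hf_nonneg : ∀ z ∈ K, 0 ≤ f z) (hg_pos : ∀ z ∈ K, f z = 0 → 0 < g z) :
    ∃ ε > 0, ∀ z ∈ K, 0 < f z + ε * g z := by
  obtain ⟨a, ha⟩ := hK.exists_bound_of_continuousOn hg
  have hcompact : IsCompact (K ∩ g ⁻¹' Iic 0) :=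
    hK.of_isClosed_subset (hg.preimage_isClosed_of_isClosed hK.isClosed isClosed_Iic)
      inter_subset_left
  obtain ⟨b, hb, hfb⟩ := hcompact.exists_forall_le' (f := f) (a := 0)
    (hf.mono inter_subset_left) fun z hz => (hf_nonneg z hz.1).lt_of_ne fun hfz =>
      (hg_pos z hz.1 hfz.symm).not_ge hz.2
  refine ⟨b / (|a| + 1), by positivity, fun z hz => ?_⟩
  rcases lt_or_ge 0 (g z) with hgz | hgz
  · exact add_pos_of_nonneg_of_pos (hf_nonneg z hz) (by positivity)
  · have hlower : -(|a| + 1) < g z := by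
      linarith [neg_le_of_abs_le (ha z hz), le_abs_self a]
    have hscaled : b / (|a| + 1) * (-(|a| + 1)) < b / (|a| + 1) * g z := by gcongr
    have hcancel : b / (|a| + 1) * (-(|a| + 1)) = -b := by field_simp
    linarith [hfb z ⟨hz, hgz⟩]

section LeviForm

variable {m k : ℕ} {ρ u : ComplexSpace m → ℝ} {z : ComplexSpace m}

theorem leviForm_apply_zero (ρ : ComplexSpace m → ℝ) (z : ComplexSpace m) : leviForm ρ z 0 = 0 := by
  simp [leviForm]

theorem leviForm_smul (ρ : ComplexSpace m → ℝ) (z v : ComplexSpace m) (t : ℝ) :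
    leviForm ρ z (t • v) = t ^ 2 * leviForm ρ z v := by
  simp only [leviForm, map_smul, smul_comm Complex.I t v, smul_apply, smul_eq_mul]
  ring

theorem leviForm_congr (h : ρ =ᶠ[𝓝 z] u) (v : ComplexSpace m) :
    leviForm ρ z v = leviForm u z v := by
  simp only [leviForm, h.fderiv.fderiv_eq]

theorem leviForm_const (c : ℝ) (z v : ComplexSpace m) : leviForm (fun _ => c) z v = 0 := by
  simp [leviForm]

theorem continuousAt_leviForm (hρ : ContDiffAt ℝ 2 ρ z) (v : ComplexSpace m) :
    ContinuousAt (fun a : ComplexSpace m × ComplexSpace m => leviForm ρ a.1 a.2) (z, v) := by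
  have hI : ContinuousAt (fun a : ComplexSpace m × ComplexSpace m => (a.1, Complex.I • a.2))
      (z, v) := by fun_prop
  exact ((continuousAt_fderiv_fderiv_apply hρ v).add (ContinuousAt.comp
    (f := fun a : ComplexSpace m × ComplexSpace m => (a.1, Complex.I • a.2))
    (continuousAt_fderiv_fderiv_apply hρ (Complex.I • v)) hI)).div_const 4

theorem leviForm_add (hρ : ContDiffAt ℝ 2 ρ z) (hu : ContDiffAt ℝ 2 u z) (v : ComplexSpace m) :
    leviForm (fun y => ρ y + u y) z v = leviForm ρ z v + leviForm u z v := by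
  have hfderiv : fderiv ℝ (fun y => ρ y + u y) =ᶠ[𝓝 z] fun y => fderiv ℝ ρ y + fderiv ℝ u y := by
    filter_upwards [eventually_contDiffAt_two hρ, eventually_contDiffAt_two hu] with y hρy huy
    exact fderiv_fun_add (hρy.differentiableAt two_ne_zero) (huy.differentiableAt two_ne_zero)
  simp only [leviForm, hfderiv.fderiv_eq, ((hasFDerivAt_fderiv_of_contDiffAt_two hρ).fun_add
    (hasFDerivAt_fderiv_of_contDiffAt_two hu)).fderiv, add_apply]
  ring

theorem leviForm_real_comp {h : ℝ → ℝ} (hh : ContDiffAt ℝ 2 h (ρ z)) (hρ : ContDiffAt ℝ 2 ρ z)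
    (v : ComplexSpace m) :
    leviForm (fun y => h (ρ y)) z v = deriv h (ρ z) * leviForm ρ z v + deriv (deriv h) (ρ z) *
      ((fderiv ℝ ρ z v ^ 2 + fderiv ℝ ρ z (Complex.I • v) ^ 2) / 4) := by
  have hfderiv : ∀ a b, fderiv ℝ (fderiv ℝ h) (ρ z) a b = a * b * deriv (deriv h) (ρ z) := by
    intro a b
    have hb := ((hasFDerivAt_fderiv_of_contDiffAt_two hh).clm_apply (hasFDerivAt_const b _)).fderiv
    simp only [fderiv_eq_smul_deriv (f := h), smul_eq_mul] at hb
    have hba := congr($hb a)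
    rw [fderiv_eq_smul_deriv, deriv_const_mul_field] at hba
    simpa [mul_assoc] using hba.symm
  simp only [leviForm, fderiv_fderiv_comp hh hρ, hfderiv, fderiv_eq_smul_deriv (f := h),
    smul_eq_mul]
  ring

theorem leviForm_const_mul (c : ℝ) (hρ : ContDiffAt ℝ 2 ρ z) (v : ComplexSpace m) :
    leviForm (fun y => c * ρ y) z v = c * leviForm ρ z v := by
  have := leviForm_real_comp (h := fun t => c * t) (by fun_prop) hρ v
  simpa using this

theorem leviForm_add_const_mul (c : ℝ) (hρ : ContDiffAt ℝ 2 ρ z) (hu : ContDiffAt ℝ 2 u z)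
    (v : ComplexSpace m) :
    leviForm (fun y => ρ y + c * u y) z v = leviForm ρ z v + c * leviForm u z v := by
  rw [leviForm_add hρ (contDiffAt_const.mul hu), leviForm_const_mul c hu]

theorem leviForm_add_mul_sq (K : ℝ) (hρ : ContDiffAt ℝ 2 ρ z) (v : ComplexSpace m) :
    leviForm (fun y => ρ y + K * ρ y ^ 2) z v = (1 + 2 * K * ρ z) * leviForm ρ z v +
      K * ((fderiv ℝ ρ z v ^ 2 + fderiv ℝ ρ z (Complex.I • v) ^ 2) / 2) := by
  have hderiv : deriv (fun t : ℝ => t + K * t ^ 2) = fun t => 1 + 2 * K * t := by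
    ext t
    simpa [mul_assoc, mul_left_comm] using
      ((hasDerivAt_id' t).fun_add (((hasDerivAt_id' t).fun_pow 2).const_mul K)).deriv
  have hcomp := leviForm_real_comp (h := fun t => t + K * t ^ 2) (by fun_prop) hρ v
  rw [hcomp, hderiv]
  simp only [deriv_const_add', deriv_const_mul_id', add_right_inj]
  ring

theorem contDiffAt_norm_sub_sq {E : Type*} [NormedAddCommGroup E] [InnerProductSpace ℝ E]
    {n : ℕ∞ω} (a z : E) :
    ContDiffAt ℝ n (fun y => ‖y - a‖ ^ 2) z :=
  (contDiffAt_id.sub contDiffAt_const).norm_sq ℝ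

theorem leviForm_norm_sub_sq (a z v : ComplexSpace m) :
    leviForm (fun y => ‖y - a‖ ^ 2) z v = ‖v‖ ^ 2 := by
  have hfderiv : fderiv ℝ (fun y : ComplexSpace m => ‖y - a‖ ^ 2) =
      fun y => (2 : ℝ) • innerSL ℝ (y - a) := by
    ext y w
    simpa using congr($(((hasFDerivAt_id y).sub_const a).norm_sq.fderiv) w)
  have hfderiv_fderiv : HasFDerivAt (fun y : ComplexSpace m => (2 : ℝ) • innerSL ℝ (y - a))
      ((2 : ℝ) • innerSL ℝ) z :=
    (((innerSL ℝ).hasFDerivAt.comp z (hasFDerivAt_sub_const a)).fun_const_smul 2).congr_fderiv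
      (by ext; simp)
  have hself : ∀ w : ComplexSpace m, innerSL ℝ w w = ‖w‖ ^ 2 := real_inner_self_eq_norm_sq
  simp only [leviForm, hfderiv, hfderiv_fderiv.fderiv, smul_apply, hself, norm_smul,
    Complex.norm_I, one_mul, smul_eq_mul]
  ring

theorem fderiv_fderiv_restrictScalars {E F : Type*} [NormedAddCommGroup E] [NormedSpace ℂ E]
    [NormedAddCommGroup F] [NormedSpace ℂ F] {φ : E → F} {z : E} (hφ : ContDiffAt ℂ 2 φ z)
    (v w : E) :
    fderiv ℝ (fderiv ℝ φ) z v w = fderiv ℂ (fderiv ℂ φ) z v w := by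
  have hfderiv : fderiv ℝ φ =ᶠ[𝓝 z]
      fun y => ContinuousLinearMap.restrictScalarsL ℂ E F ℝ ℝ (fderiv ℂ φ y) := by
    filter_upwards [hφ.eventually (by norm_num)] with y hy
    exact (hy.differentiableAt two_ne_zero).fderiv_restrictScalars ℝ
  have hderiv := ((hφ.fderiv_right (m := 1) (by norm_num)).differentiableAt
    one_ne_zero).hasFDerivAt.restrictScalars ℝ
  have hcomp := (ContinuousLinearMap.restrictScalarsL ℂ E F ℝ ℝ).hasFDerivAt.comp z hderiv
  rw [hfderiv.fderiv_eq]
  exact congr($(hcomp.fderiv) v w)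

theorem leviForm_comp {f : ComplexSpace k → ℝ} {φ : ComplexSpace m → ComplexSpace k}
    (hf : ContDiffAt ℝ 2 f (φ z)) (hφ : ContDiffAt ℂ 2 φ z) (v : ComplexSpace m) :
    leviForm (fun y => f (φ y)) z v = leviForm f (φ z) (fderiv ℂ φ z v) := by
  have hdφ : ∀ w, fderiv ℝ φ z w = fderiv ℂ φ z w := by
    simp [(hφ.differentiableAt two_ne_zero).fderiv_restrictScalars ℝ]
  simp only [leviForm, fderiv_fderiv_comp hf (hφ.restrict_scalars ℝ),
    fderiv_fderiv_restrictScalars hφ, hdφ, map_smul, smul_apply, smul_smul, Complex.I_mul_I,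
    neg_smul, one_smul, map_neg]
  ring

theorem leviForm_nonpos_of_isLocalMax (hu : ContDiffAt ℝ 2 u z) (hmax : IsLocalMax u z)
    (v : ComplexSpace m) : leviForm u z v ≤ 0 := by
  have hv := fderiv_fderiv_apply_nonpos_of_isLocalMax hu hmax v
  have hIv := fderiv_fderiv_apply_nonpos_of_isLocalMax hu hmax (Complex.I • v)
  rw [leviForm]
  linarith

/-- Plurisubharmonicity of `u` at the point `z`, the hypothesis of the maximum principles below:
`u` is of class `C²` at `z` and its Levi form there is positive semidefinite. Semicontinuous `u` are
not considered. -/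
structure IsPlurisubharmonicAt (u : ComplexSpace m → ℝ) (z : ComplexSpace m) : Prop where
  contDiffAt : ContDiffAt ℝ 2 u z
  leviForm_nonneg : ∀ v, 0 ≤ leviForm u z v

theorem IsPlurisubharmonicAt.comp {f : ComplexSpace k → ℝ} {φ : ComplexSpace m → ComplexSpace k}
    (hf : IsPlurisubharmonicAt f (φ z)) (hφ : ContDiffAt ℂ 2 φ z) :
    IsPlurisubharmonicAt (fun y => f (φ y)) z where
  contDiffAt := hf.contDiffAt.comp z (hφ.restrict_scalars ℝ)
  leviForm_nonneg v := leviForm_comp hf.contDiffAt hφ v ▸ hf.leviForm_nonneg _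

end LeviForm

theorem fderiv_apply_nonpos_of_eventually_le {E : Type*} [NormedAddCommGroup E] [NormedSpace ℝ E]
    {ρ g : E → ℝ} {x w : E} (hρ : DifferentiableAt ℝ ρ x) (hg : DifferentiableAt ℝ g x)
    (hle : ∀ᶠ y in 𝓝 x, ρ y < ρ x → g y ≤ g x) (hw : fderiv ℝ ρ x w < 0) :
    fderiv ℝ g x w ≤ 0 := by
  by_contra! hpos
  have hline : Tendsto (fun s : ℝ => x + s • w) (𝓝[>] 0) (𝓝 x) := by
    have hcont : Continuous fun s : ℝ => x + s • w := by fun_prop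
    simpa using (hcont.tendsto 0).mono_left nhdsWithin_le_nhds
  have hneg : 0 < fderiv ℝ (fun y => -ρ y) x w := by simpa [fderiv_fun_neg] using hw
  obtain ⟨s, hs, hρs, hgs⟩ := ((hline.eventually hle).and
    ((eventually_lt_of_fderiv_pos hρ.neg hneg).and (eventually_lt_of_fderiv_pos hg hpos))).exists
  exact hgs.not_ge (hs (neg_lt_neg_iff.mp hρs))

theorem frontier_closedBall_inter_sublevel_subset {X : Type*} [PseudoMetricSpace X] {ρ : X → ℝ}
    {p : X} {r : ℝ} (hρ : ContinuousOn ρ (closedBall p r)) :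
    frontier {y ∈ closedBall p r | ρ y ≤ 0} ⊆
      {y ∈ sphere p r | ρ y ≤ 0} ∪ {y ∈ closedBall p r | ρ y = 0} := by
  intro z hz
  have hclosed : IsClosed {y ∈ closedBall p r | ρ y ≤ 0} :=
    hρ.preimage_isClosed_of_isClosed isClosed_closedBall isClosed_Iic
  obtain ⟨hzball, hρz⟩ := hclosed.frontier_subset hz
  rcases hρz.eq_or_lt with hρz | hρz
  · exact Or.inr ⟨hzball, hρz⟩
  refine Or.inl ⟨(mem_closedBall.mp hzball).eq_or_lt.resolve_right fun hlt => hz.2 ?_, hρz.le⟩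
  have hball : closedBall p r ∈ 𝓝 z := closedBall_mem_nhds_of_mem hlt
  exact mem_interior_iff_mem_nhds.mpr (inter_mem hball
    ((hρ.continuousAt hball).eventually (Iic_mem_nhds hρz)))

section MaximumPrinciple

variable {m : ℕ} {ρ u : ComplexSpace m → ℝ} {p : ComplexSpace m}

theorem le_of_le_frontier_of_exists_leviForm_pos {K : Set (ComplexSpace m)} (hK : IsCompact K)
    {C : ℝ} (hu : ContinuousOn u K) (hdiff : ∀ z ∈ interior K, ContDiffAt ℝ 2 u z)
    (hlevi : ∀ z ∈ interior K, ∃ v, 0 < leviForm u z v) (hle : ∀ z ∈ frontier K, u z ≤ C) :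
    ∀ z ∈ K, u z ≤ C := by
  intro z hz
  obtain ⟨y, hy, hmax⟩ := hK.exists_isMaxOn ⟨z, hz⟩ hu
  refine (hmax hz).trans ?_
  by_cases hyint : y ∈ interior K
  · obtain ⟨v, hv⟩ := hlevi y hyint
    exact absurd hv (leviForm_nonpos_of_isLocalMax (hdiff y hyint)
      (hmax.isLocalMax (mem_interior_iff_mem_nhds.mp hyint)) v).not_gt
  · exact hle y ⟨subset_closure hy, hyint⟩

theorem le_of_le_sphere_of_le_zero_set {r C : ℝ} (hρ : ContinuousOn ρ (closedBall p r))
    (hu : ∀ z ∈ closedBall p r, ContDiffAt ℝ 2 u z)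
    (hlevi : ∀ z ∈ closedBall p r, ∃ v, 0 < leviForm u z v)
    (hsphere : ∀ z ∈ sphere p r, ρ z ≤ 0 → u z ≤ C)
    (hzero : ∀ z ∈ closedBall p r, ρ z = 0 → u z ≤ C) :
    ∀ z ∈ closedBall p r, ρ z ≤ 0 → u z ≤ C := by
  intro z hz hρz
  refine le_of_le_frontier_of_exists_leviForm_pos (K := {y ∈ closedBall p r | ρ y ≤ 0})
    ((isCompact_closedBall p r).of_isClosed_subset
      (hρ.preimage_isClosed_of_isClosed isClosed_closedBall isClosed_Iic) inter_subset_left)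
    (fun y hy => (hu y hy.1).continuousAt.continuousWithinAt)
    (fun y hy => hu y (interior_subset hy).1) (fun y hy => hlevi y (interior_subset hy).1)
    (fun y hy => ?_) z ⟨hz, hρz⟩
  exact (frontier_closedBall_inter_sublevel_subset hρ hy).elim (fun h => hsphere y h.1 h.2)
    fun h => hzero y h.1 h.2

theorem IsPlurisubharmonicAt.leviForm_add_const_mul_norm_sub_sq_pos
    (hu : IsPlurisubharmonicAt u p) (a : ComplexSpace m) {ε : ℝ} (hε : 0 < ε) {v : ComplexSpace m}
    (hv : v ≠ 0) : 0 < leviForm (fun y => u y + ε * ‖y - a‖ ^ 2) p v := by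
  have hsq := contDiffAt_norm_sub_sq (n := 2) a p
  rw [leviForm_add_const_mul ε hu.contDiffAt hsq, leviForm_norm_sub_sq]
  have := hu.leviForm_nonneg v
  positivity

theorem le_of_le_frontier_of_isPlurisubharmonicAt [Nontrivial (ComplexSpace m)]
    {K : Set (ComplexSpace m)} (hK : IsCompact K) {C : ℝ} (hu : ContinuousOn u K)
    (hpsh : ∀ z ∈ interior K, IsPlurisubharmonicAt u z) (hle : ∀ z ∈ frontier K, u z ≤ C) :
    ∀ z ∈ K, u z ≤ C := by
  intro z hz
  obtain ⟨v, hv⟩ := exists_ne (0 : ComplexSpace m)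
  obtain ⟨R, hR⟩ := hK.exists_bound_of_continuousOn
    (f := fun y : ComplexSpace m => ‖y - 0‖ ^ 2) (by fun_prop)
  replace hR : ∀ y ∈ K, ‖y - 0‖ ^ 2 ≤ R := fun y hy => (Real.le_norm_self _).trans (hR y hy)
  have hperturbed : ∀ ε > 0, u z ≤ C + ε * R := by
    intro ε hε
    refine (le_add_of_nonneg_right (by positivity)).trans <|
      le_of_le_frontier_of_exists_leviForm_pos (u := fun y => u y + ε * ‖y - 0‖ ^ 2) hK
        (hu.add (by fun_prop)) (fun y hy => (hpsh y hy).contDiffAt.add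
          (contDiffAt_const.mul (contDiffAt_norm_sub_sq 0 y)))
        (fun y hy => ⟨v, (hpsh y hy).leviForm_add_const_mul_norm_sub_sq_pos 0 hε hv⟩)
        (fun y hy => ?_) z hz
    have := hR y (hK.isClosed.frontier_subset hy)
    gcongr
    exact hle y hy
  have hlim : Tendsto (fun ε => C + ε * R) (𝓝[>] 0) (𝓝 C) := by
    have hcont : Continuous fun ε => C + ε * R := by fun_prop
    simpa using (hcont.tendsto 0).mono_left nhdsWithin_le_nhds
  exact ge_of_tendsto hlim (eventually_nhdsWithin_of_forall hperturbed)

theorem exists_barrier (hρ : ContDiffAt ℝ 2 ρ p) (hρp : ρ p = 0) (hdρ : fderiv ℝ ρ p ≠ 0) :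
    ∃ b : ComplexSpace m → ℝ, ContDiffAt ℝ 2 b p ∧ fderiv ℝ b p = fderiv ℝ ρ p ∧
      (∀ z, ρ z = 0 → b z = ‖z - p‖ ^ 2) ∧ ∃ v, ∀ᶠ z in 𝓝 p, leviForm b z v < 0 := by
  obtain ⟨v, hv⟩ := DFunLike.ne_iff.mp hdρ
  -- Subtracting a multiple of `ρ²` changes neither `b` on `{ρ = 0}` nor its differential at `p`,
  -- but makes its Levi form as negative as desired in a direction `v` transverse to `{ρ = 0}`.
  set D := (fderiv ℝ ρ p v ^ 2 + fderiv ℝ ρ p (Complex.I • v) ^ 2) / 2 with hD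
  have hDpos : 0 < D := by
    have := sq_pos_of_ne_zero hv
    positivity
  set K := (leviForm ρ p v + ‖v‖ ^ 2 + 1) / D with hK
  have hsq := contDiffAt_norm_sub_sq (n := 2) p p
  have hbent : ContDiffAt ℝ 2 (fun z => ρ z + -K * ρ z ^ 2) p := by fun_prop
  have hb := hbent.add hsq
  refine ⟨fun z => (ρ z + -K * ρ z ^ 2) + ‖z - p‖ ^ 2, hb, ?_, fun z hz => by simp [hz], v, ?_⟩
  · have hρ' := (hρ.differentiableAt two_ne_zero).hasFDerivAt
    have hsq' := ((hasFDerivAt_id p).sub_const p).norm_sq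
    have := ((hρ'.fun_add ((hρ'.pow 2).const_mul (-K))).fun_add hsq').fderiv
    simpa [hρp] using this
  · have hneg : leviForm (fun z => (ρ z + -K * ρ z ^ 2) + ‖z - p‖ ^ 2) p v < 0 := by
      rw [leviForm_add hbent hsq, leviForm_add_mul_sq (-K) hρ, leviForm_norm_sub_sq, hρp, ← hD]
      have : K * D = leviForm ρ p v + ‖v‖ ^ 2 + 1 := by rw [hK, div_mul_cancel₀ _ hDpos.ne']
      linarith
    have hpair : ContinuousAt (fun z : ComplexSpace m => (z, v)) p := by fun_prop
    exact (ContinuousAt.comp (f := fun z : ComplexSpace m => (z, v))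
      (continuousAt_leviForm hb v) hpair).eventually (gt_mem_nhds hneg)

theorem exists_pos_eventually_add_const_mul_le {b : ComplexSpace m → ℝ} {v : ComplexSpace m}
    (hρ : ContDiffAt ℝ 2 ρ p) (hb : ContDiffAt ℝ 2 b p)
    (hbzero : ∀ z, ρ z = 0 → b z = ‖z - p‖ ^ 2) (hblevi : ∀ᶠ z in 𝓝 p, leviForm b z v < 0)
    (hu : ∀ᶠ z in 𝓝 p, IsPlurisubharmonicAt u z) (hneg : ∀ᶠ z in 𝓝 p, ρ z < 0 → u z < u p)
    (hzero : ∀ᶠ z in 𝓝 p, ρ z = 0 → u z ≤ u p) :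
    ∃ ε > 0, ∀ᶠ z in 𝓝 p, ρ z ≤ 0 → u z + -ε * b z ≤ u p := by
  obtain ⟨r, hr, hball⟩ := nhds_basis_closedBall.eventually_iff.mp
    ((eventually_contDiffAt_two hρ).and ((eventually_contDiffAt_two hb).and
      (hblevi.and (hu.and (hneg.and hzero)))))
  simp only [imp_and, forall_and] at hball
  obtain ⟨hρ, hb, hblevi, hu, hneg, hzero⟩ := hball
  have hρc : ContinuousOn ρ (closedBall p r) :=
    fun z hz => (hρ z hz).continuousAt.continuousWithinAt
  have hbc : ContinuousOn b (closedBall p r) :=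
    fun z hz => (hb z hz).continuousAt.continuousWithinAt
  have huc : ContinuousOn u (closedBall p r) :=
    fun z hz => (hu z hz).contDiffAt.continuousAt.continuousWithinAt
  have hcapball : {z ∈ sphere p r | ρ z ≤ 0} ⊆ closedBall p r :=
    fun z hz => sphere_subset_closedBall hz.1
  have hcap : IsCompact {z ∈ sphere p r | ρ z ≤ 0} :=
    (isCompact_sphere p r).of_isClosed_subset ((hρc.mono
      sphere_subset_closedBall).preimage_isClosed_of_isClosed isClosed_sphere isClosed_Iic)
      inter_subset_left
  obtain ⟨ε, hε, hεcap⟩ := exists_pos_forall_add_mul_pos (f := fun z => u p - u z) (g := b) hcap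
    ((continuousOn_const.sub huc).mono hcapball) (hbc.mono hcapball)
    (fun z hz => sub_nonneg.mpr <|
      hz.2.lt_or_eq.elim (fun h => (hneg z (hcapball hz) h).le) (hzero z (hcapball hz))) (by
      intro z hz huz
      have hρz : ρ z = 0 := hz.2.eq_or_lt.resolve_right fun hlt =>
        (hneg z (hcapball hz) hlt).ne (sub_eq_zero.mp huz).symm
      rw [hbzero z hρz, ← dist_eq_norm, mem_sphere.mp hz.1]
      positivity)
  have hmax := le_of_le_sphere_of_le_zero_set hρc (u := fun z => u z + -ε * b z) (C := u p)
    (fun z hz => (hu z hz).contDiffAt.add (contDiffAt_const.mul (hb z hz)))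
    (fun z hz => by
      refine ⟨v, ?_⟩
      rw [leviForm_add_const_mul (-ε) (hu z hz).contDiffAt (hb z hz)]
      linarith [(hu z hz).leviForm_nonneg v, mul_neg_of_pos_of_neg hε (hblevi z hz)])
    (fun z hz hρz => by linarith [hεcap z ⟨hz, hρz⟩])
    (fun z hz hρz => by
      have : 0 ≤ ε * b z := hbzero z hρz ▸ by positivity
      linarith [hzero z hz hρz])
  exact ⟨ε, hε, by filter_upwards [closedBall_mem_nhds p hr] with z hz using hmax z hz⟩

theorem fderiv_ne_zero_of_eventually_lt (hρ : ContDiffAt ℝ 2 ρ p) (hρp : ρ p = 0)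
    (hdρ : fderiv ℝ ρ p ≠ 0) (hu : ∀ᶠ z in 𝓝 p, IsPlurisubharmonicAt u z)
    (hneg : ∀ᶠ z in 𝓝 p, ρ z < 0 → u z < u p) (hzero : ∀ᶠ z in 𝓝 p, ρ z = 0 → u z ≤ u p) :
    fderiv ℝ u p ≠ 0 := by
  intro hdu
  obtain ⟨b, hb, hdb, hbzero, v, hblevi⟩ := exists_barrier hρ hρp hdρ
  obtain ⟨ε, hε, hle⟩ :=
    exists_pos_eventually_add_const_mul_le hρ hb hbzero hblevi hu hneg hzero
  obtain ⟨w, hw⟩ : ∃ w, fderiv ℝ ρ p w < 0 := by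
    by_contra! hnonneg
    exact hdρ (ContinuousLinearMap.ext fun w =>
      le_antisymm (by simpa using hnonneg (-w)) (hnonneg w))
  have hdu' := (hu.self_of_nhds.contDiffAt.differentiableAt two_ne_zero).hasFDerivAt
  have hdb' := (hb.differentiableAt two_ne_zero).hasFDerivAt
  have hg := hdu'.fun_add (hdb'.const_mul (-ε))
  have hnonpos := fderiv_apply_nonpos_of_eventually_le (hρ.differentiableAt two_ne_zero)
    hg.differentiableAt (by
      filter_upwards [hle] with z hz hρz
      simpa [hbzero p hρp] using hz (hρz.le.trans_eq hρp)) hw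
  rw [hg.fderiv, hdu, hdb] at hnonpos
  simp only [zero_add, smul_apply, smul_eq_mul] at hnonpos
  nlinarith

theorem eventually_eq_of_isLocalMax (hu : ∀ᶠ z in 𝓝 p, IsPlurisubharmonicAt u z)
    (hmax : IsLocalMax u p) : ∀ᶠ z in 𝓝 p, u z = u p := by
  obtain ⟨δ, hδ, hball⟩ := Metric.eventually_nhds_iff_ball.mp
    (hu.eventually_nhds.and (eventually_eventually_nhds.mpr hmax))
  filter_upwards [ball_mem_nhds p (half_pos hδ)] with y hy
  by_contra hne
  have hsub : closedBall y (dist p y) ⊆ ball p δ := fun z hz => by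
    have := dist_triangle z y p
    rw [mem_ball] at hy ⊢
    rw [mem_closedBall, dist_comm p] at hz
    linarith
  have huc : ContinuousOn u (closedBall y (dist p y)) := fun z hz =>
    (hball z (hsub hz)).1.self_of_nhds.contDiffAt.continuousAt.continuousWithinAt
  -- At a point `q` of `{u = u p}` nearest to `y`, the ball about `y` through `q` contradicts the
  -- Hopf lemma, since `q` is a local maximum and hence a critical point.
  obtain ⟨q, ⟨hqball, huq⟩, hqmin⟩ := ((isCompact_closedBall y (dist p y)).of_isClosed_subset
    (huc.preimage_isClosed_of_isClosed isClosed_closedBall (isClosed_singleton (x := u p)))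
    inter_subset_left).exists_isMinOn ⟨p, mem_closedBall.mpr le_rfl, rfl⟩
    (continuous_id.dist continuous_const : Continuous fun z => dist z y).continuousOn
  obtain ⟨hpsh, hle⟩ := hball q (hsub hqball)
  have huq : u q = u p := huq
  have hqy : q - y ≠ 0 := sub_ne_zero.mpr fun h => hne (h ▸ huq)
  have hsq := ((hasFDerivAt_id (𝕜 := ℝ) q).sub_const y).norm_sq.sub_const (‖q - y‖ ^ 2)
  refine fderiv_ne_zero_of_eventually_lt (ρ := fun z => ‖z - y‖ ^ 2 - ‖q - y‖ ^ 2) (u := u)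
    (p := q) ((contDiffAt_norm_sub_sq y q).sub contDiffAt_const) (sub_self _)
    (fun h => hqy ?_) hpsh ?_ ?_ ?_
  · have := congr($(hsq.fderiv.symm.trans h) (q - y))
    simpa [-map_sub] using this
  · filter_upwards [hle] with z hz hρz
    have hzy : dist z y < dist q y := by
      rw [dist_eq_norm, dist_eq_norm]
      exact lt_of_pow_lt_pow_left₀ 2 (norm_nonneg _) (sub_neg.mp hρz)
    rw [huq]
    exact hz.lt_of_ne fun hzp =>
      (hqmin ⟨(hzy.trans_le hqball).le, hzp⟩ : dist q y ≤ dist z y).not_gt hzy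
  · filter_upwards [hle] with z hz _ using huq ▸ hz
  · exact IsLocalMax.fderiv_eq_zero (by filter_upwards [hle] with z hz using huq ▸ hz)

theorem eventually_eq_zero_or_fderiv_ne_zero (hρ : ContDiffAt ℝ 2 ρ p) (hρp : ρ p = 0)
    (hdρ : fderiv ℝ ρ p ≠ 0) (hu : AnalyticAt ℝ u p) (hup : u p = 0)
    (hpsh : ∀ᶠ z in 𝓝 p, IsPlurisubharmonicAt u z) (hside : ∀ᶠ z in 𝓝 p, ρ z ≤ 0 → u z ≤ 0) :
    (∀ᶠ z in 𝓝 p, u z = 0) ∨ fderiv ℝ u p ≠ 0 := by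
  by_cases hneg : ∀ᶠ z in 𝓝 p, ρ z < 0 → u z < u p
  · exact Or.inr (fderiv_ne_zero_of_eventually_lt hρ hρp hdρ hpsh hneg
      (by filter_upwards [hside] with z hz hρz using hup ▸ hz hρz.le))
  left
  obtain ⟨δ, hδ, hball⟩ := Metric.eventually_nhds_iff_ball.mp (hu.eventually_analyticAt.and
    (hpsh.eventually_nhds.and (hside.eventually_nhds.and (eventually_contDiffAt_two hρ))))
  obtain ⟨z, ⟨hzneg, hz⟩⟩ := ((not_eventually.mp hneg).and_eventually (ball_mem_nhds p hδ)).exists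
  obtain ⟨hρz, huz⟩ := Classical.not_imp.mp hzneg
  rw [hup, not_lt] at huz
  obtain ⟨-, hpshz, hsidez, hcont⟩ := hball z hz
  have huz : u z = 0 := le_antisymm (hsidez.self_of_nhds hρz.le) huz
  have hmax : IsLocalMax u z := by
    filter_upwards [hsidez, hcont.continuousAt.eventually (gt_mem_nhds hρz)] with y hy hρy
      using huz ▸ hy hρy.le
  have heq : EqOn u 0 (ball p δ) := AnalyticOnNhd.eqOn_of_preconnected_of_eventuallyEq (𝕜 := ℝ)
    (fun y hy => (hball y hy).1) analyticOnNhd_const (convex_ball p δ).isPreconnected hz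
    (by filter_upwards [eventually_eq_of_isLocalMax hpshz hmax] with y hy using hy.trans huz)
  filter_upwards [ball_mem_nhds p hδ] with y hy using heq hy

end MaximumPrinciple

section TangentDisc

variable {m : ℕ} {ρ u : ComplexSpace m → ℝ} {p ξ : ComplexSpace m}

theorem exists_ne_zero_mem_complexTangentSpace (hm : 2 ≤ m) (ρ : ComplexSpace m → ℝ)
    (p : ComplexSpace m) : ∃ ξ ∈ complexTangentSpace ρ p, ξ ≠ 0 := by
  have hker := LinearMap.ker_ne_bot_of_finrank_lt
    (f := (StrongDual.extendRCLike (𝕜 := ℂ) (fderiv ℝ ρ p)).toLinearMap)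
    (by simpa using Nat.lt_of_succ_le hm)
  obtain ⟨ξ, hξ, hne⟩ := (Submodule.ne_bot_iff _).mp hker
  have hξ : StrongDual.extendRCLike (𝕜 := ℂ) (fderiv ℝ ρ p) ξ = 0 := hξ
  exact ⟨ξ, ⟨by simpa using congr(RCLike.re $hξ), by simpa using congr(RCLike.im $hξ)⟩, hne⟩

theorem exists_apply_eq_and_apply_I_smul_eq {E : Type*} [NormedAddCommGroup E] [NormedSpace ℂ E]
    {L : E →L[ℝ] ℝ} (hL : L ≠ 0) (a b : ℝ) : ∃ η, L η = a ∧ L (Complex.I • η) = b := by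
  have hextend : StrongDual.extendRCLike (𝕜 := ℂ) L ≠ 0 := fun h =>
    hL (ContinuousLinearMap.ext fun x => by simpa using congr(RCLike.re ($h x)))
  obtain ⟨η, hη⟩ := LinearMap.surjective_of_ne_zero
    (f := (StrongDual.extendRCLike (𝕜 := ℂ) L).toLinearMap)
    (fun h => hextend (ContinuousLinearMap.coe_injective h)) (a - b * Complex.I)
  have hη : StrongDual.extendRCLike (𝕜 := ℂ) L η = a - b * Complex.I := hη
  refine ⟨η, ?_, ?_⟩
  · simpa using congr(RCLike.re $hη)
  · simpa using congr(RCLike.im $hη)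

theorem exists_apply_smul_add_apply_smul_eq_norm_sq_mul {E : Type*} [NormedAddCommGroup E]
    [NormedSpace ℂ E] {L : E →L[ℝ] ℝ} (hL : L ≠ 0) {H : E →L[ℝ] E →L[ℝ] ℝ}
    (hH : ∀ v w, H v w = H w v) (ξ : E) :
    ∃ η, ∀ a : ℂ, H (a • ξ) (a • ξ) + L ((2 * a ^ 2) • η) =
      ‖a‖ ^ 2 * ((H ξ ξ + H (Complex.I • ξ) (Complex.I • ξ)) / 2) := by
  -- `H (a • ξ) (a • ξ)` is a Hermitian term in `a` plus `Re (κ * a ^ 2)` for some `κ : ℂ`; this `η`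
  -- cancels the latter.
  obtain ⟨η, hη, hIη⟩ := exists_apply_eq_and_apply_I_smul_eq hL
    ((H (Complex.I • ξ) (Complex.I • ξ) - H ξ ξ) / 4) (-(H ξ (Complex.I • ξ)) / 2)
  refine ⟨η, fun a => ?_⟩
  have hsmul : ∀ (c : ℂ) (v : E), c • v = c.re • v + c.im • Complex.I • v := fun c v => by
    rw [← Complex.coe_smul c.re, ← Complex.coe_smul c.im, smul_smul, ← add_smul, Complex.re_add_im]
  rw [hsmul a ξ, hsmul _ η, ← Complex.normSq_eq_norm_sq, Complex.normSq_apply]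
  simp only [map_add, map_smul, add_apply, smul_apply, smul_eq_mul, hη, hIη,
    hH (Complex.I • ξ) ξ, pow_two, Complex.mul_re, Complex.mul_im, Complex.re_ofNat,
    Complex.im_ofNat]
  ring

theorem fderiv_fderiv_smul_add_sq_smul {E F : Type*} [NormedAddCommGroup E] [NormedSpace ℂ E]
    [NormedAddCommGroup F] [NormedSpace ℂ F] (π : E →L[ℂ] ℂ) (ξ η : F) :
    fderiv ℂ (fun t => π t • ξ + π t ^ 2 • η) 0 = π.smulRight ξ ∧
      ∀ s, fderiv ℂ (fderiv ℂ fun t => π t • ξ + π t ^ 2 • η) 0 s s = (2 * π s ^ 2) • η := by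
  have hfderiv : (fderiv ℂ fun t => π t • ξ + π t ^ 2 • η) =
      fun t => π.smulRight ξ + π t • (2 : ℂ) • π.smulRight η := by
    ext t s
    have := ((π.hasFDerivAt (x := t)).smul_const ξ).fun_add
      (((π.hasFDerivAt (x := t)).pow 2).smul_const η)
    rw [this.fderiv]
    simp [smul_smul, mul_comm, mul_left_comm]
  refine ⟨by simp [hfderiv], fun s => ?_⟩
  have := ((π.hasFDerivAt (x := (0 : E))).smul_const ((2 : ℂ) • π.smulRight η)).const_add
    (π.smulRight ξ)
  rw [hfderiv, this.fderiv]
  simp [smul_smul, pow_two, mul_left_comm, mul_assoc]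

theorem exists_tangent_disc (hρ : ContDiffAt ℝ 2 ρ p) (hρp : ρ p = 0) (hdρ : fderiv ℝ ρ p ≠ 0)
    (hξ : ξ ∈ complexTangentSpace ρ p) (hlevi : 0 < leviForm ρ p ξ) :
    ∃ γ : ComplexSpace 1 → ComplexSpace m,
      ContDiff ℂ 2 γ ∧ γ 0 = 0 ∧ ∀ᶠ t in 𝓝[≠] 0, 0 < ρ (p + γ t) := by
  let π : ComplexSpace 1 →L[ℂ] ℂ := EuclideanSpace.proj 0
  have hπ : ∀ t, ‖π t‖ = ‖t‖ := fun t => by simp [π, EuclideanSpace.norm_eq]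
  obtain ⟨η, hη⟩ := exists_apply_smul_add_apply_smul_eq_norm_sq_mul hdρ
    (hρ.isSymmSndFDerivAt (by simp)).eq ξ
  obtain ⟨hdγ, hddγ⟩ := fderiv_fderiv_smul_add_sq_smul π ξ η
  set γ : ComplexSpace 1 → ComplexSpace m := fun t => π t • ξ + π t ^ 2 • η with hγdef
  have hγ : ContDiff ℂ 2 γ := by fun_prop
  have hγ0 : γ 0 = 0 := by simp [hγdef]
  have hγℝ : ContDiffAt ℝ 2 (fun t => p + γ t) 0 :=
    contDiffAt_const.add (hγ.contDiffAt.restrict_scalars ℝ)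
  have hρ0 : ContDiffAt ℝ 2 ρ (p + γ 0) := by rwa [hγ0, add_zero]
  have hdγℝ : ∀ t, fderiv ℝ (fun t => p + γ t) 0 t = π t • ξ := fun t => by
    rw [fderiv_const_add, (hγ.contDiffAt.differentiableAt two_ne_zero).fderiv_restrictScalars ℝ,
      ContinuousLinearMap.coe_restrictScalars', hdγ, ContinuousLinearMap.smulRight_apply]
  have hddγℝ : ∀ t, fderiv ℝ (fderiv ℝ fun t => p + γ t) 0 t t = (2 * π t ^ 2) • η := fun t => by
    have htranslate : (fderiv ℝ fun t => p + γ t) = fderiv ℝ γ := funext fun _ => fderiv_const_add p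
    rw [htranslate, fderiv_fderiv_restrictScalars hγ.contDiffAt, hddγ]
  refine ⟨γ, hγ, hγ0, ?_⟩
  have hmin := eventually_lt_of_fderiv_fderiv_coercive (f := fun t => ρ (p + γ t)) (x := 0)
    (c := 2 * leviForm ρ p ξ) (hρ0.comp 0 hγℝ) ?_ (by positivity) fun t => ?_
  · simpa only [hγ0, add_zero, hρp] using hmin
  · ext t
    rw [fderiv_fun_comp 0 (hρ0.differentiableAt two_ne_zero) (hγℝ.differentiableAt two_ne_zero),
      ContinuousLinearMap.comp_apply, hdγℝ, hγ0, add_zero, ← Complex.re_add_im (π t), add_smul,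
      mul_smul, map_add, Complex.coe_smul, Complex.coe_smul, map_smul, map_smul, hξ.1, hξ.2]
    simp
  · rw [fderiv_fderiv_comp (h := fun t => p + γ t) hρ0 hγℝ, hdγℝ, hddγℝ, hγ0, add_zero, hη,
      hπ, leviForm]
    linarith

theorem comp_le_of_sphere_pos {k : ℕ} [Nontrivial (ComplexSpace k)]
    {γ : ComplexSpace k → ComplexSpace m} {a : ComplexSpace k} {r C : ℝ}
    (hγ : ∀ t ∈ closedBall a r, ContDiffAt ℂ 2 γ t)
    (hρ : ∀ t ∈ closedBall a r, ContinuousAt ρ (γ t))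
    (hpsh : ∀ t ∈ closedBall a r, IsPlurisubharmonicAt u (γ t))
    (hzero : ∀ t ∈ closedBall a r, ρ (γ t) = 0 → u (γ t) ≤ C)
    (hpos : ∀ t ∈ sphere a r, 0 < ρ (γ t)) :
    ∀ t ∈ closedBall a r, ρ (γ t) ≤ 0 → u (γ t) ≤ C := by
  intro t ht hρt
  have hρc : ContinuousOn (fun t => ρ (γ t)) (closedBall a r) := fun s hs =>
    ((hρ s hs).comp (hγ s hs).continuousAt).continuousWithinAt
  have hupsh : ∀ s ∈ closedBall a r, IsPlurisubharmonicAt (fun t => u (γ t)) s :=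
    fun s hs => (hpsh s hs).comp (hγ s hs)
  exact le_of_le_frontier_of_isPlurisubharmonicAt (u := fun t => u (γ t))
    (K := {t ∈ closedBall a r | ρ (γ t) ≤ 0})
    ((isCompact_closedBall a r).of_isClosed_subset
      (hρc.preimage_isClosed_of_isClosed isClosed_closedBall isClosed_Iic) inter_subset_left)
    (fun s hs => (hupsh s hs.1).contDiffAt.continuousAt.continuousWithinAt)
    (fun s hs => hupsh s (interior_subset hs).1)
    (fun s hs => (frontier_closedBall_inter_sublevel_subset hρc hs).elim
      (fun h => absurd h.2 (hpos s h.1).not_ge) fun h => hzero s h.1 h.2) t ⟨ht, hρt⟩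

theorem eventually_le_of_nonpos_of_leviForm_pos {C : ℝ} (hρ : ContDiffAt ℝ 2 ρ p) (hρp : ρ p = 0)
    (hdρ : fderiv ℝ ρ p ≠ 0) (hξ : ξ ∈ complexTangentSpace ρ p) (hlevi : 0 < leviForm ρ p ξ)
    (hpsh : ∀ᶠ z in 𝓝 p, IsPlurisubharmonicAt u z) (hzero : ∀ᶠ z in 𝓝 p, ρ z = 0 → u z ≤ C) :
    ∀ᶠ z in 𝓝 p, ρ z ≤ 0 → u z ≤ C := by
  obtain ⟨γ, hγ, hγ0, hpos⟩ := exists_tangent_disc hρ hρp hdρ hξ hlevi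
  have htranslate : Continuous fun a : ComplexSpace m × ComplexSpace 1 => a.1 + γ a.2 :=
    continuous_fst.add (hγ.continuous.comp continuous_snd)
  have hlim : Tendsto (fun a : ComplexSpace m × ComplexSpace 1 => a.1 + γ a.2)
      (𝓝 p ×ˢ 𝓝 0) (𝓝 p) := by
    simpa [nhds_prod_eq, hγ0] using htranslate.tendsto (p, 0)
  obtain ⟨P, hP, Q, hQ, hgood⟩ := eventually_prod_iff.mp (hlim.eventually
    ((eventually_contDiffAt_two hρ).and (hpsh.and hzero)))
  obtain ⟨r, hr, hball⟩ := nhds_basis_closedBall.eventually_iff.mp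
    (hQ.and (eventually_nhdsWithin_iff.mp hpos))
  have hboundary : ∀ᶠ z in 𝓝 p, ∀ t ∈ sphere (0 : ComplexSpace 1) r, 0 < ρ (z + γ t) := by
    refine (isCompact_sphere 0 r).eventually_forall_of_forall_eventually fun t ht => ?_
    obtain ⟨hQt, ht0⟩ := hball (sphere_subset_closedBall ht)
    exact (ContinuousAt.comp (f := fun a : ComplexSpace m × ComplexSpace 1 => a.1 + γ a.2)
      (hgood hP.self_of_nhds hQt).1.continuousAt htranslate.continuousAt).eventually
      (lt_mem_nhds (ht0 (ne_of_mem_sphere ht hr.ne')))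
  filter_upwards [hP, hboundary] with z hz hpos hρz
  replace hgood := fun t ht => hgood hz (hball (x := t) ht).1
  have hle := comp_le_of_sphere_pos (γ := fun t => z + γ t)
    (fun t _ => contDiffAt_const.add hγ.contDiffAt) (fun t ht => (hgood t ht).1.continuousAt)
    (fun t ht => (hgood t ht).2.1) (fun t ht => (hgood t ht).2.2) hpos 0 (mem_closedBall_self hr.le)
  simpa [hγ0] using hle (by simpa [hγ0] using hρz)

end TangentDisc

section StrictlyPlurisubharmonic

variable {m : ℕ} {ρ : ComplexSpace m → ℝ} {z : ComplexSpace m}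

theorem leviForm_pos_of_forall_mem_sphere
    (h : ∀ v ∈ sphere (0 : ComplexSpace m) 1, 0 < leviForm ρ z v) {v : ComplexSpace m}
    (hv : v ≠ 0) : 0 < leviForm ρ z v := by
  have hunit := h (‖v‖⁻¹ • v) (by simp [norm_smul, hv])
  rw [leviForm_smul] at hunit
  exact pos_of_mul_pos_right hunit (by positivity)

theorem eventually_leviForm_pos (hρ : ContDiffAt ℝ 2 ρ z) (hlevi : ∀ v ≠ 0, 0 < leviForm ρ z v) :
    ∀ᶠ y in 𝓝 z, ∀ v ≠ 0, 0 < leviForm ρ y v := by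
  have hsphere := (isCompact_sphere (0 : ComplexSpace m) 1).eventually_forall_of_forall_eventually
    (P := fun y v => 0 < leviForm ρ y v) fun v hv => (continuousAt_leviForm hρ v).eventually
      (lt_mem_nhds (hlevi v (ne_of_mem_sphere hv one_ne_zero)))
  filter_upwards [hsphere] with y hy v hv using leviForm_pos_of_forall_mem_sphere hy hv

theorem exists_leviForm_add_mul_sq_pos (hρ : ContDiffAt ℝ 2 ρ z) (hρz : ρ z = 0)
    (hlevi : ∀ v ∈ complexTangentSpace ρ z, v ≠ 0 → 0 < leviForm ρ z v) :
    ∃ K : ℝ, ∀ v ≠ 0, 0 < leviForm (fun y => ρ y + K * ρ y ^ 2) z v := by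
  have hleviForm : Continuous (leviForm ρ z) := by
    unfold leviForm
    fun_prop
  obtain ⟨ε, hε, hpos⟩ := exists_pos_forall_add_mul_pos
    (f := fun v => (fderiv ℝ ρ z v ^ 2 + fderiv ℝ ρ z (Complex.I • v) ^ 2) / 2)
    (isCompact_sphere (0 : ComplexSpace m) 1) (by fun_prop) hleviForm.continuousOn
    (fun v _ => by positivity) (fun v hv hzero => by
      have hv' : fderiv ℝ ρ z v = 0 := by
        nlinarith [sq_nonneg (fderiv ℝ ρ z v), sq_nonneg (fderiv ℝ ρ z (Complex.I • v))]
      have hIv : fderiv ℝ ρ z (Complex.I • v) = 0 := by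
        nlinarith [sq_nonneg (fderiv ℝ ρ z v), sq_nonneg (fderiv ℝ ρ z (Complex.I • v))]
      exact hlevi v ⟨hv', hIv⟩ (ne_of_mem_sphere hv one_ne_zero))
  refine ⟨ε⁻¹, fun v hv => leviForm_pos_of_forall_mem_sphere (fun w hw => ?_) hv⟩
  have hscaled := mul_pos (inv_pos.mpr hε) (hpos w hw)
  rw [mul_add, inv_mul_cancel_left₀ hε.ne'] at hscaled
  rw [leviForm_add_mul_sq _ hρ, hρz]
  linarith

theorem IsStronglyPseudoconvexAnalyticHypersurface.exists_strictly_plurisubharmonic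
    {M : Set (ComplexSpace m)} (hM : IsStronglyPseudoconvexAnalyticHypersurface M) (hz : z ∈ M) :
    ∃ σ : ComplexSpace m → ℝ, AnalyticAt ℝ σ z ∧ (∀ᶠ y in 𝓝 z, y ∈ M → σ y = 0) ∧
      ∀ᶠ y in 𝓝 z, ∀ v ≠ 0, 0 < leviForm σ y v := by
  obtain ⟨V, ρ, hzV, hρ, hlevi⟩ := hM z hz
  have hzero : ∀ y ∈ V, y ∈ M → ρ y = 0 := fun y hyV hyM => (hρ.inter_eq.subset ⟨hyM, hyV⟩).2
  have hρz := hρ.analytic z hzV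
  obtain ⟨K, hK⟩ := exists_leviForm_add_mul_sq_pos hρz.contDiffAt (hzero z hzV hz) hlevi
  have hσ : AnalyticAt ℝ (fun y => ρ y + K * ρ y ^ 2) z := by fun_prop
  refine ⟨_, hσ, ?_, eventually_leviForm_pos hσ.contDiffAt hK⟩
  filter_upwards [hρ.isOpen.mem_nhds hzV] with y hyV hyM
  simp [hzero y hyV hyM]

end StrictlyPlurisubharmonic

section HolomorphicMapping

variable {m k : ℕ} {ρ : ComplexSpace m → ℝ} {σ : ComplexSpace k → ℝ}
  {φ : ComplexSpace m → ComplexSpace k} {p : ComplexSpace m}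

theorem eventually_eq_const_of_comp_eq_zero (hφ : AnalyticAt ℂ φ p) (hσ : ContDiffAt ℝ 2 σ (φ p))
    (hlevi : ∀ᶠ w in 𝓝 (φ p), ∀ v ≠ 0, 0 < leviForm σ w v)
    (hzero : ∀ᶠ z in 𝓝 p, σ (φ z) = 0) : ∀ᶠ z in 𝓝 p, φ z = φ p := by
  have hdφ : ∀ᶠ z in 𝓝 p, fderiv ℂ φ z = 0 := by
    filter_upwards [hφ.eventually_analyticAt, hφ.continuousAt.eventually hlevi,
      hφ.continuousAt.eventually (eventually_contDiffAt_two hσ), hzero.eventually_nhds]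
      with z hφz hleviz hσz hzeroz
    ext1 v
    by_contra hv
    have hpos := hleviz _ hv
    rw [← leviForm_comp hσz hφz.contDiffAt, leviForm_congr hzeroz, leviForm_const] at hpos
    exact hpos.false
  obtain ⟨r, hr, hball⟩ := Metric.eventually_nhds_iff_ball.mp (hφ.eventually_analyticAt.and hdφ)
  filter_upwards [ball_mem_nhds p hr] with z hz
  exact isOpen_ball.is_const_of_fderiv_eq_zero (𝕜 := ℂ) (convex_ball p r).isPreconnected
    (fun y hy => (hball y hy).1.differentiableAt.differentiableWithinAt)
    (fun y hy => (hball y hy).2) hz (mem_ball_self hr)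

theorem injective_fderiv_of_fderiv_comp_ne_zero (hρ : ContDiffAt ℝ 2 ρ p) (hρp : ρ p = 0)
    (hdρ : fderiv ℝ ρ p ≠ 0) (hlevi : ∀ v ∈ complexTangentSpace ρ p, v ≠ 0 → 0 < leviForm ρ p v)
    (hφ : ContDiffAt ℂ 2 φ p) (hσ : ContDiffAt ℝ 2 σ (φ p))
    (hzero : ∀ᶠ z in 𝓝 p, ρ z = 0 → σ (φ z) = 0) (hdu : fderiv ℝ (fun z => σ (φ z)) p ≠ 0) :
    Function.Injective (fderiv ℂ φ p) := by
  have hσd := hσ.differentiableAt two_ne_zero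
  have hφd := hφ.differentiableAt two_ne_zero
  obtain ⟨c, hgrad, hhess⟩ := exists_fderiv_eq_smul_of_eventually_eq_zero (u := fun z => σ (φ z))
    hρ (hσ.comp p (hφ.restrict_scalars ℝ)) hdρ hρp hzero
  have hc : c ≠ 0 := fun hc => hdu (by simpa [hc] using hgrad)
  have hker : ∀ w, fderiv ℂ φ p w = 0 → fderiv ℝ ρ p w = 0 := fun w hw => by
    have hw' := congr($hgrad w)
    rw [fderiv_fun_comp p hσd (hφd.restrictScalars ℝ), ContinuousLinearMap.comp_apply,
      hφd.fderiv_restrictScalars ℝ, ContinuousLinearMap.coe_restrictScalars', hw, map_zero] at hw'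
    simpa [hc] using hw'.symm
  refine (injective_iff_map_eq_zero _).mpr fun v hv => ?_
  have hdρv := hker v hv
  have hdρIv := hker (Complex.I • v) (by rw [map_smul, hv, smul_zero])
  have hleviForm : leviForm (fun z => σ (φ z)) p v = c * leviForm ρ p v := by
    rw [leviForm, hhess v hdρv, hhess _ hdρIv, leviForm]
    ring
  rw [leviForm_comp hσ hφ, hv, leviForm_apply_zero, zero_eq_mul] at hleviForm
  by_contra hne
  exact (hlevi v ⟨hdρv, hdρIv⟩ hne).ne' (hleviForm.resolve_left hc)

theorem eventually_eq_const_or_injective_fderiv (hm : 2 ≤ m) (hρ : ContDiffAt ℝ 2 ρ p)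
    (hρp : ρ p = 0) (hdρ : fderiv ℝ ρ p ≠ 0)
    (hlevi : ∀ v ∈ complexTangentSpace ρ p, v ≠ 0 → 0 < leviForm ρ p v)
    (hφ : AnalyticAt ℂ φ p) (hσ : AnalyticAt ℝ σ (φ p))
    (hσlevi : ∀ᶠ w in 𝓝 (φ p), ∀ v ≠ 0, 0 < leviForm σ w v)
    (hzero : ∀ᶠ z in 𝓝 p, ρ z = 0 → σ (φ z) = 0) :
    (∀ᶠ z in 𝓝 p, φ z = φ p) ∨ Function.Injective (fderiv ℂ φ p) := by
  obtain ⟨ξ, hξ, hξ0⟩ := exists_ne_zero_mem_complexTangentSpace hm ρ p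
  have hu : AnalyticAt ℝ (fun z => σ (φ z)) p := hσ.comp hφ.restrictScalars
  have hpsh : ∀ᶠ z in 𝓝 p, IsPlurisubharmonicAt (fun z => σ (φ z)) z := by
    filter_upwards [hφ.eventually_analyticAt, hφ.continuousAt.eventually hσlevi,
      hφ.continuousAt.eventually hσ.eventually_analyticAt] with z hφz hleviz hσz
    refine IsPlurisubharmonicAt.comp ⟨hσz.contDiffAt, fun v => ?_⟩ hφz.contDiffAt
    rcases eq_or_ne v 0 with rfl | hv
    · exact (leviForm_apply_zero σ (φ z)).ge
    · exact (hleviz v hv).le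
  have hside := eventually_le_of_nonpos_of_leviForm_pos hρ hρp hdρ hξ (hlevi ξ hξ hξ0) hpsh
    (by filter_upwards [hzero] with z hz hρz using (hz hρz).le)
  rcases eventually_eq_zero_or_fderiv_ne_zero hρ hρp hdρ hu (hzero.self_of_nhds hρp) hpsh hside
    with hu0 | hdu
  · exact Or.inl (eventually_eq_const_of_comp_eq_zero hφ hσ.contDiffAt hσlevi hu0)
  · exact Or.inr (injective_fderiv_of_fderiv_comp_ne_zero hρ hρp hdρ hlevi hφ.contDiffAt
      hσ.contDiffAt hzero hdu)

end HolomorphicMapping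

section Immersion

variable {𝕜 E F : Type*} [NontriviallyNormedField 𝕜] [CompleteSpace 𝕜] [NormedAddCommGroup E]
  [NormedSpace 𝕜 E] [FiniteDimensional 𝕜 E] [NormedAddCommGroup F] [NormedSpace 𝕜 F]

theorem exists_mem_nhds_injOn_of_hasStrictFDerivAt_injective {φ : E → F} {φ' : E →L[𝕜] F} {p : E}
    (hφ : HasStrictFDerivAt φ φ' p) (hinj : Function.Injective φ') : ∃ s ∈ 𝓝 p, InjOn φ s := by
  obtain ⟨K, hK, hφ'⟩ := φ'.toLinearMap.injective_iff_antilipschitz.mp hinj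
  obtain ⟨s, hs, happrox⟩ := hφ.approximates_deriv_on_nhds (c := K⁻¹ / 2) (Or.inr (by positivity))
  have hanti := (hφ'.domRestrict s).add_sub_lipschitzWith happrox.lipschitz_sub
    (NNReal.half_lt_self (inv_pos.mpr hK).ne')
  exact ⟨s, hs, injOn_iff_injective.mpr hanti.injective⟩

theorem exists_isOpen_injOn_injective_fderiv [CompleteSpace F] {φ : E → F} {U : Set E} {p : E}
    (hU : IsOpen U) (hp : p ∈ U) (hφ : AnalyticAt 𝕜 φ p)
    (hinj : Function.Injective (fderiv 𝕜 φ p)) :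
    ∃ V ⊆ U, IsOpen V ∧ p ∈ V ∧ InjOn φ V ∧ ∀ z ∈ V, Function.Injective (fderiv 𝕜 φ z) := by
  obtain ⟨s, hs, hs_inj⟩ := exists_mem_nhds_injOn_of_hasStrictFDerivAt_injective
    hφ.hasStrictFDerivAt hinj
  obtain ⟨V, hV, hVopen, hpV⟩ := _root_.eventually_nhds_iff.mp ((hφ.fderiv.continuousAt.eventually
    (ContinuousLinearMap.isOpen_injective.mem_nhds hinj)).and
    ((hU.eventually_mem hp).and (eventually_mem_set.mpr hs)))
  exact ⟨V, fun z hz => (hV z hz).2.1, hVopen, hpV, hs_inj.mono fun z hz => (hV z hz).2.2,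
    fun z hz => (hV z hz).1⟩

end Immersion

theorem isBiholomorphicOn_of_injOn {m : ℕ} {φ : ComplexSpace m → ComplexSpace m}
    {V : Set (ComplexSpace m)} (hV : IsOpen V) (hφ : AnalyticOnNhd ℂ φ V) (hinj : InjOn φ V)
    (hdinj : ∀ z ∈ V, Function.Injective (fderiv ℂ φ z)) : IsBiholomorphicOn φ V := by
  have hequiv : ∀ z ∈ V, ∃ e : ComplexSpace m ≃L[ℂ] ComplexSpace m, fderiv ℂ φ z = e :=
    fun z hz => ⟨(LinearEquiv.ofInjectiveEndo (fderiv ℂ φ z).toLinearMap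
      (hdinj z hz)).toContinuousLinearEquiv, rfl⟩
  have hopen : IsOpenMap (V.domRestrict φ) := IsOpenMap.of_nhds_le fun z => by
    obtain ⟨e, he⟩ := hequiv z z.2
    have hmap := (he ▸ (hφ z z.2).hasStrictFDerivAt).map_nhds_eq_of_equiv
    rw [domRestrict_eq, ← Filter.map_map, map_nhds_subtype_coe_eq_nhds z.2 (hV.mem_nhds z.2), hmap,
      Function.comp_apply]
  let F := OpenPartialHomeomorph.ofContinuousOpenRestrict (hinj.toPartialEquiv φ V)
    (fun z hz => (hφ z hz).continuousAt.continuousWithinAt) hopen hV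
  refine ⟨hV, F.open_target, hφ, hinj, F.symm, ?_, fun z hz => F.left_inv hz⟩
  rintro _ ⟨z, hz, rfl⟩
  obtain ⟨e, he⟩ := hequiv z hz
  exact F.analyticAt_symm' hz (hφ z hz) he

theorem mainTheorem11_general {m k : ℕ} (hm : 2 ≤ m) {M : Set (ComplexSpace m)}
    {M' : Set (ComplexSpace k)} (hM : IsStronglyPseudoconvexAnalyticHypersurface M)
    (hM' : IsStronglyPseudoconvexAnalyticHypersurface M') {p : ComplexSpace m} (hp : p ∈ M)
    {U : Set (ComplexSpace m)} (hU : IsOpen U) (hpU : p ∈ U) {φ : ComplexSpace m → ComplexSpace k}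
    (hφ : AnalyticOnNhd ℂ φ U) (hφM : ∀ z ∈ U ∩ M, φ z ∈ M') :
    ∃ V ⊆ U, IsOpen V ∧ p ∈ V ∧ ((∃ c, ∀ z ∈ V, φ z = c) ∨
      (InjOn φ V ∧ ∀ z ∈ V, Function.Injective (fderiv ℂ φ z))) := by
  obtain ⟨W, ρ, hpW, hρ, hlevi⟩ := hM p hp
  obtain ⟨σ, hσ, hσzero, hσlevi⟩ := hM'.exists_strictly_plurisubharmonic (hφM p ⟨hpU, hp⟩)
  have hφp := hφ p hpU
  have hρp : ρ p = 0 := (hρ.inter_eq.subset ⟨hp, hpW⟩).2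
  have hzero : ∀ᶠ z in 𝓝 p, ρ z = 0 → σ (φ z) = 0 := by
    filter_upwards [hU.mem_nhds hpU, hρ.isOpen.mem_nhds hpW, hφp.continuousAt.eventually hσzero]
      with z hzU hzW hz hρz
    exact hz (hφM z ⟨hzU, (hρ.inter_eq.superset ⟨hzW, hρz⟩).1⟩)
  rcases eventually_eq_const_or_injective_fderiv hm (hρ.analytic p hpW).contDiffAt hρp
    (hρ.fderiv_ne_zero p hpW) hlevi hφp hσ hσlevi hzero with hconst | hinj
  · obtain ⟨V, hV, hVopen, hpV⟩ :=
      _root_.eventually_nhds_iff.mp (hconst.and (hU.eventually_mem hpU))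
    exact ⟨V, fun z hz => (hV z hz).2, hVopen, hpV, Or.inl ⟨φ p, fun z hz => (hV z hz).1⟩⟩
  · obtain ⟨V, hVU, hVopen, hpV, hV⟩ := exists_isOpen_injOn_injective_fderiv hU hpU hφp hinj
    exact ⟨V, hVU, hVopen, hpV, Or.inr hV⟩

theorem mainTheorem11 (n : ℕ) (hn : 1 ≤ n)
    (M M' : Set (ComplexSpace (n + 1)))
    (hM : IsStronglyPseudoconvexAnalyticHypersurface M)
    (hM' : IsStronglyPseudoconvexAnalyticHypersurface M')
    (p : ComplexSpace (n + 1)) (hp : p ∈ M)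
    (U : Set (ComplexSpace (n + 1))) (hU : IsOpen U) (hpU : p ∈ U)
    (φ : ComplexSpace (n + 1) → ComplexSpace (n + 1))
    (hφ : AnalyticOnNhd ℂ φ U)
    (hφM : ∀ z ∈ U ∩ M, φ z ∈ M') :
    ∃ V : Set (ComplexSpace (n + 1)), IsOpen V ∧ p ∈ V ∧ V ⊆ U ∧
      ((∃ c : ComplexSpace (n + 1), ∀ z ∈ V, φ z = c) ∨ IsBiholomorphicOn φ V) := by
  obtain ⟨V, hVU, hV, hpV, h⟩ :=
    mainTheorem11_general (Nat.succ_le_succ hn) hM hM' hp hU hpU hφ hφM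
  exact ⟨V, hV, hpV, hVU, h.imp_right fun ⟨hinj, hdinj⟩ =>
    isBiholomorphicOn_of_injOn hV (hφ.mono hVU) hinj hdinj⟩
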